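/- Let $\mathbb D=\{z\in\mathbb C:|z|<1\}$, and let $\mathcal A$ be the class of functions $f$ analytic in $\mathbb D$ with a power series $f(z)=z+\sum_{n=2}^{\infty}a_nz^n$ there. Let $\mathcal G_{sh}$ be the class of all $f\in\mathcal A$ with $$\frac{zf'(z)}{f(z)}-1\prec\sinh z ,$$ that is, $f(z)\neq0$ for $0<|z|<1$ and there is an analytic function $\omega$ in $\mathbb D$ with $|\omega(z)|\le|z|$ and $\frac{zf'(z)}{f(z)}-1=\sinh(\omega(z))$ for all $z\in\mathbb D$, the left-hand side being given its limit value $0$ at $z=0$. For every $f\in\mathcal G_{sh}$ the third Hankel determinant (with $a_1=1$) $$H_{3,1}(f)=\det\begin{pmatrix}a_1&a_2&a_3\\a_2&a_3&a_4\\a_3&a_4&a_5\end{pmatrix}=a_3(a_2a_4-a_3^2)-a_4(a_4-a_2a_3)+a_5(a_3-a_2^2)$$ satisfies $$|H_{3,1}(f)|\le\frac14 .$$ -/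

import Mathlib

/-- The open unit disc `𝔻` of the complex plane. -/
def unitDisc : Set ℂ := Metric.ball (0 : ℂ) 1

/-- The class `𝒜`: functions analytic in the open unit disc with `f(0) = 0` and `f'(0) = 1`, that is
with a power series `f(z) = z + a₂ z² + a₃ z³ + ⋯` there. -/
structure IsClassA (f : ℂ → ℂ) : Prop where
  analytic : AnalyticOnNhd ℂ f unitDisc
  map_zero : f 0 = 0
  deriv_zero : deriv f 0 = 1

/-- The Taylor coefficient `aₙ` of `f` at the origin. -/
noncomputable def taylorCoeff (f : ℂ → ℂ) (n : ℕ) : ℂ :=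
  iteratedDeriv n f 0 / (n.factorial : ℂ)

/-- A Schwarz function: `ω` is analytic in the open unit disc and `|ω(z)| ≤ |z|` there. -/
structure IsSchwarzFunction (ω : ℂ → ℂ) : Prop where
  analytic : AnalyticOnNhd ℂ ω unitDisc
  norm_le : ∀ z ∈ unitDisc, ‖ω z‖ ≤ ‖z‖

/-- Subordination `f₁ ≺ f₂` in the open unit disc: `f₁ = f₂ ∘ ω` there for a Schwarz function `ω`. -/
def Subordinate (f₁ f₂ : ℂ → ℂ) : Prop :=
  ∃ ω : ℂ → ℂ, IsSchwarzFunction ω ∧ ∀ z ∈ unitDisc, f₁ z = f₂ (ω z)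

/-- The function `z f'(z) / f(z) - 1`. For `f` in the class `𝒜` it has a removable singularity at the
origin, with value `0` there. -/
noncomputable def starlikeQuotient (f : ℂ → ℂ) : ℂ → ℂ :=
  Function.update (fun z => z * deriv f z / f z - 1) 0 0

/-- The class `𝒢_sh`: functions `f` of the class `𝒜` with `z f'(z) / f(z) - 1 ≺ sinh z`. The
condition `ne_zero` says that the denominator vanishes at no point of the disc besides the origin, so
that the quotient is an analytic function in the disc. -/
structure IsClassGsh (f : ℂ → ℂ) : Prop where
  classA : IsClassA f
  ne_zero : ∀ z ∈ unitDisc, z ≠ 0 → f z ≠ 0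
  subordinate : Subordinate (starlikeQuotient f) Complex.sinh

/-- The Hankel determinant `H_{q,n}(f)`, the determinant of the `q × q` matrix with entries
`a_{n+i+j}`, `0 ≤ i, j < q`. -/
noncomputable def hankelDet (q n : ℕ) (f : ℂ → ℂ) : ℂ :=
  (Matrix.of fun i j : Fin q => taylorCoeff f (n + (i : ℕ) + (j : ℕ))).det

/-! Write `ω = c₁z + c₂z² + ⋯`. Comparing coefficients in `z f' = f (1 + sinh ω)` makes `a₂, …, a₅`,
hence the determinant, polynomials in `c₁, …, c₄`. Since `|ω| ≤ 1`, Parseval on circles gives `∑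
|cₙ|² ≤ 1` (`sum_sq_taylorCoeff_le`). This alone suffices: in `norm_hankel_polynomial_le` the
triangle inequality dominates the polynomial by a quadratic form in the `|cₙ|` that is at most a
quarter of their square sum. -/

open Finset in
lemma taylorCoeff_mul {f g : ℂ → ℂ} (hf : AnalyticAt ℂ f 0) (hg : AnalyticAt ℂ g 0) (n : ℕ) :
    taylorCoeff (fun z => f z * g z) n =
      ∑ i ∈ range (n + 1), taylorCoeff f i * taylorCoeff g (n - i) := by
  unfold taylorCoeff
  rw [iteratedDeriv_fun_mul hf.contDiffAt hg.contDiffAt, sum_div]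
  refine sum_congr rfl fun i hi => ?_
  have hin : i ≤ n := Nat.lt_succ_iff.1 (mem_range.1 hi)
  rw [Nat.cast_choose ℂ hin]
  have h1 : (n.factorial : ℂ) ≠ 0 := by exact_mod_cast n.factorial_ne_zero
  have h2 : (i.factorial : ℂ) ≠ 0 := by exact_mod_cast i.factorial_ne_zero
  have h3 : ((n - i).factorial : ℂ) ≠ 0 := by exact_mod_cast (n - i).factorial_ne_zero
  field_simp

lemma taylorCoeff_deriv (f : ℂ → ℂ) (n : ℕ) :
    taylorCoeff (deriv f) n = (n + 1) * taylorCoeff f (n + 1) := by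
  have h1 : (n.factorial : ℂ) ≠ 0 := by exact_mod_cast n.factorial_ne_zero
  have h2 : (n + 1 : ℂ) ≠ 0 := by exact_mod_cast n.succ_ne_zero
  unfold taylorCoeff
  rw [iteratedDeriv_succ', Nat.factorial_succ]
  push_cast
  field_simp

lemma taylorCoeff_zero (f : ℂ → ℂ) : taylorCoeff f 0 = f 0 := by simp [taylorCoeff]

lemma taylorCoeff_congr {f g : ℂ → ℂ} (h : ∀ z ∈ unitDisc, f z = g z) (n : ℕ) :
    taylorCoeff f n = taylorCoeff g n := by
  have h0 : f =ᶠ[nhds 0] g :=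
    Filter.eventually_of_mem (Metric.ball_mem_nhds _ one_pos) h
  rw [taylorCoeff, taylorCoeff, h0.iteratedDeriv_eq]

lemma taylorCoeff_id (n : ℕ) : taylorCoeff id n = if n = 1 then 1 else 0 := by
  have h : iteratedDeriv n (id : ℂ → ℂ) 0 = if n = 1 then 1 else 0 := iteratedDeriv_fun_id_zero
  rw [taylorCoeff, h]
  split_ifs with hn <;> simp [hn]

/-- Cauchy's formula for the `n`-th derivative, parametrised by the angle, is a Fourier integral. -/
lemma fourierCoeffOn_circleMap {f : ℂ → ℂ} (hf : AnalyticOnNhd ℂ f unitDisc) {r : ℝ}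
    (hr : 0 < r) (hr1 : r < 1) (n : ℕ) :
    fourierCoeffOn Real.two_pi_pos (fun θ => f (circleMap 0 r θ)) n = taylorCoeff f n * r ^ n := by
  have hsub : Metric.closedBall (0 : ℂ) r ⊆ unitDisc := Metric.closedBall_subset_ball hr1
  have hd : DifferentiableOn ℂ f (Metric.closedBall 0 r) :=
    (hf.differentiableOn).mono hsub
  have h := hd.circleIntegral_one_div_sub_center_pow_smul hr n
  rw [circleIntegral] at h
  have hrC : (r : ℂ) ≠ 0 := by exact_mod_cast hr.ne'
  -- The factor `i r e^{iθ}` from `dz` cancels one of the `n + 1` powers in the kernel.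
  have hpt : ∀ θ : ℝ, deriv (circleMap 0 r) θ • ((1 / (circleMap 0 r θ - 0) ^ (n + 1)) •
      f (circleMap 0 r θ)) = (Complex.I / r ^ n) *
        (fourier (-(n : ℤ)) (θ : AddCircle (2 * Real.pi - 0)) • f (circleMap 0 r θ)) := by
    intro θ
    rw [fourier_coe_apply, deriv_circleMap, sub_zero]
    have hc : circleMap 0 r θ = r * Complex.exp (θ * Complex.I) := by simp [circleMap]
    have he : Complex.exp (2 * Real.pi * Complex.I * ((-(n : ℤ) : ℤ) : ℂ) * θ /
        ((2 * Real.pi - 0 : ℝ) : ℂ)) = (Complex.exp (θ * Complex.I) ^ n)⁻¹ := by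
      rw [← Complex.exp_nat_mul, ← Complex.exp_neg]
      congr 1
      have : (Real.pi : ℂ) ≠ 0 := by exact_mod_cast Real.pi_ne_zero
      push_cast
      field_simp
      simp
      ring
    have hexp := Complex.exp_ne_zero (θ * Complex.I)
    rw [he]
    generalize f (circleMap 0 r θ) = w
    rw [hc]
    simp only [smul_eq_mul]
    field_simp
    ring
  simp_rw [hpt] at h
  rw [intervalIntegral.integral_const_mul] at h
  rw [fourierCoeffOn_eq_integral, taylorCoeff]
  generalize (∫ x in (0 : ℝ)..2 * Real.pi, fourier (-(n : ℤ)) (x : AddCircle (2 * Real.pi - 0)) •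
    f (circleMap 0 r x)) = J at h ⊢
  have hpi : (Real.pi : ℂ) ≠ 0 := by exact_mod_cast Real.pi_ne_zero
  have hn : (n.factorial : ℂ) ≠ 0 := by exact_mod_cast n.factorial_ne_zero
  have hJ : J = r ^ n * (2 * Real.pi / n.factorial * iteratedDeriv n f 0) := by
    have hI := Complex.I_ne_zero
    simp only [smul_eq_mul] at h
    field_simp at h ⊢
    linear_combination h
  rw [hJ]
  simp only [Complex.real_smul]
  push_cast
  rw [sub_zero]
  field_simp

lemma sum_sq_taylorCoeff_mul_pow_le {f : ℂ → ℂ} (hf : AnalyticOnNhd ℂ f unitDisc)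
    (hb : ∀ z ∈ unitDisc, ‖f z‖ ≤ 1) (N : ℕ) {r : ℝ} (hr : 0 < r) (hr1 : r < 1) :
    ∑ n ∈ Finset.range N, (‖taylorCoeff f n‖ * r ^ n) ^ 2 ≤ 1 := by
  have hmem : ∀ θ, circleMap 0 r θ ∈ unitDisc := fun θ => by
    simp [unitDisc, abs_of_pos hr, hr1]
  have hcont : Continuous fun θ : ℝ => f (circleMap 0 r θ) :=
    hf.continuousOn.comp_continuous (continuous_circleMap 0 r) hmem
  have hbd : ∀ θ : ℝ, ‖f (circleMap 0 r θ)‖ ≤ 1 := fun θ => hb _ (hmem θ)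
  have hL2 : MeasureTheory.MemLp (fun θ : ℝ => f (circleMap 0 r θ)) 2
      (MeasureTheory.volume.restrict (Set.Ioc 0 (2 * Real.pi))) :=
    MeasureTheory.MemLp.of_bound hcont.aestronglyMeasurable 1 (Filter.Eventually.of_forall hbd)
  have hs := hasSum_sq_fourierCoeffOn Real.two_pi_pos hL2
  -- Parseval runs over `ℤ`; only the frequencies `0, …, N - 1` are kept.
  have hle := sum_le_hasSum ((Finset.range N).map Nat.castEmbedding)
    (fun i _ => sq_nonneg _) hs
  rw [Finset.sum_map] at hle
  simp only [Nat.castEmbedding_apply, fourierCoeffOn_circleMap hf hr hr1, norm_mul, norm_pow,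
    Complex.norm_real, Real.norm_of_nonneg hr.le] at hle
  refine hle.trans ?_
  have hint : ∫ θ in (0 : ℝ)..2 * Real.pi, ‖f (circleMap 0 r θ)‖ ^ 2 ≤
      ∫ _ in (0 : ℝ)..2 * Real.pi, (1 : ℝ) := by
    refine intervalIntegral.integral_mono Real.two_pi_pos.le
      ((hcont.norm.pow 2).intervalIntegrable _ _) intervalIntegrable_const fun θ => ?_
    exact pow_le_one₀ (norm_nonneg _) (hbd θ)
  rw [intervalIntegral.integral_const, smul_eq_mul, mul_one] at hint
  rw [smul_eq_mul, inv_mul_le_iff₀ (by simpa using Real.two_pi_pos)]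
  simpa using hint

/-- Bessel's inequality for the Taylor coefficients of an analytic self-map of the unit disc. -/
lemma sum_sq_taylorCoeff_le {f : ℂ → ℂ} (hf : AnalyticOnNhd ℂ f unitDisc)
    (hb : ∀ z ∈ unitDisc, ‖f z‖ ≤ 1) (N : ℕ) :
    ∑ n ∈ Finset.range N, ‖taylorCoeff f n‖ ^ 2 ≤ 1 := by
  have ht : Filter.Tendsto (fun r : ℝ => ∑ n ∈ Finset.range N, (‖taylorCoeff f n‖ * r ^ n) ^ 2)
      (nhdsWithin 1 (Set.Iio 1)) (nhds (∑ n ∈ Finset.range N, (‖taylorCoeff f n‖ * 1 ^ n) ^ 2)) :=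
    (Continuous.tendsto (by fun_prop) 1).mono_left nhdsWithin_le_nhds
  simp only [one_pow, mul_one] at ht
  refine le_of_tendsto ht ?_
  filter_upwards [Ioo_mem_nhdsLT (zero_lt_one' ℝ)] with r hr
  exact sum_sq_taylorCoeff_mul_pow_le hf hb N hr.1 hr.2

/-- The first Taylor coefficients of `sinh ∘ ω`. -/
lemma taylorCoeff_sinh_comp {ω : ℂ → ℂ} (hω : AnalyticAt ℂ ω 0) (h0 : ω 0 = 0) :
    taylorCoeff (fun z => Complex.sinh (ω z)) 1 = taylorCoeff ω 1 ∧
    taylorCoeff (fun z => Complex.sinh (ω z)) 2 = taylorCoeff ω 2 ∧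
    taylorCoeff (fun z => Complex.sinh (ω z)) 3 = taylorCoeff ω 3 + taylorCoeff ω 1 ^ 3 / 6 ∧
    taylorCoeff (fun z => Complex.sinh (ω z)) 4 =
      taylorCoeff ω 4 + taylorCoeff ω 1 ^ 2 * taylorCoeff ω 2 / 2 := by
  set s : ℂ → ℂ := fun z => Complex.sinh (ω z) with hs
  set k : ℂ → ℂ := fun z => Complex.cosh (ω z) with hk
  have hsA : AnalyticAt ℂ s 0 := (Complex.analyticAt_sinh).comp hω
  have hkA : AnalyticAt ℂ k 0 := (Complex.analyticAt_cosh).comp hω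
  have hev : ∀ᶠ z in nhds (0 : ℂ), DifferentiableAt ℂ ω z :=
    hω.eventually_analyticAt.mono fun z hz => hz.differentiableAt
  have hds : deriv s =ᶠ[nhds 0] fun z => k z * deriv ω z :=
    hev.mono fun z hz => hz.hasDerivAt.csinh.deriv
  have hdk : deriv k =ᶠ[nhds 0] fun z => s z * deriv ω z :=
    hev.mono fun z hz => hz.hasDerivAt.ccosh.deriv
  -- The system `s' = k ω'`, `k' = s ω'` yields coupled recursions for the coefficients.
  have es (n : ℕ) := (taylorCoeff_deriv s n).symm.trans
    ((congrArg (· / (n.factorial : ℂ)) (hds.iteratedDeriv_eq n)).trans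
      (taylorCoeff_mul hkA hω.deriv n))
  have ek (n : ℕ) := (taylorCoeff_deriv k n).symm.trans
    ((congrArg (· / (n.factorial : ℂ)) (hdk.iteratedDeriv_eq n)).trans
      (taylorCoeff_mul hsA hω.deriv n))
  have s0 : taylorCoeff s 0 = 0 := by simp [taylorCoeff_zero, hs, h0]
  have k0 : taylorCoeff k 0 = 1 := by simp [taylorCoeff_zero, hk, h0]
  have s1 := es 0
  have s2 := es 1
  have s3 := es 2
  have s4 := es 3
  have k1 := ek 0
  have k2 := ek 1
  have k3 := ek 2
  norm_num [Finset.sum_range_succ, taylorCoeff_deriv, s0, k0] at s1 s2 s3 s4 k1 k2 k3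
  rw [k1] at s2 s3 s4
  rw [s1] at k2 k3
  have k2' : taylorCoeff k 2 = taylorCoeff ω 1 ^ 2 / 2 := by linear_combination k2 / 2
  have s2' : taylorCoeff s 2 = taylorCoeff ω 2 := by linear_combination s2 / 2
  rw [s2'] at k3
  have k3' : taylorCoeff k 3 = taylorCoeff ω 1 * taylorCoeff ω 2 := by linear_combination k3 / 3
  rw [k2'] at s3 s4
  rw [k3'] at s4
  refine ⟨s1, s2', ?_, ?_⟩
  · linear_combination s3 / 3
  · linear_combination s4 / 4

lemma IsClassGsh.mul_deriv_eq {f ω : ℂ → ℂ} (hf : IsClassGsh f)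
    (h : ∀ z ∈ unitDisc, starlikeQuotient f z = Complex.sinh (ω z)) {z : ℂ} (hz : z ∈ unitDisc) :
    z * deriv f z = f z * (1 + Complex.sinh (ω z)) := by
  by_cases h0 : z = 0
  · simp [h0, hf.classA.map_zero]
  · have hq := h z hz
    have hfz := hf.ne_zero z hz h0
    rw [starlikeQuotient, Function.update_of_ne h0] at hq
    rw [← hq]
    field_simp
    ring

/-- The first Taylor coefficients of a function `f` with `z f'(z) = f(z) (1 + p(z))`. -/
lemma taylorCoeff_of_mul_deriv_eq {f p : ℂ → ℂ} (hfA : IsClassA f) (hp : AnalyticAt ℂ p 0)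
    (hp0 : p 0 = 0) (h : ∀ z ∈ unitDisc, z * deriv f z = f z * (1 + p z)) :
    taylorCoeff f 1 = 1 ∧
    taylorCoeff f 2 = taylorCoeff p 1 ∧
    2 * taylorCoeff f 3 = taylorCoeff p 2 + taylorCoeff p 1 * taylorCoeff f 2 ∧
    3 * taylorCoeff f 4 = taylorCoeff p 3 + taylorCoeff p 2 * taylorCoeff f 2 +
      taylorCoeff p 1 * taylorCoeff f 3 ∧
    4 * taylorCoeff f 5 = taylorCoeff p 4 + taylorCoeff p 3 * taylorCoeff f 2 +
      taylorCoeff p 2 * taylorCoeff f 3 + taylorCoeff p 1 * taylorCoeff f 4 := by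
  have hf : AnalyticAt ℂ f 0 := hfA.analytic 0 (Metric.mem_ball_self one_pos)
  have a0 : taylorCoeff f 0 = 0 := by rw [taylorCoeff_zero, hfA.map_zero]
  have a1 : taylorCoeff f 1 = 1 := by simp [taylorCoeff, hfA.deriv_zero]
  have hc (n : ℕ) := (taylorCoeff_mul analyticAt_id hf.deriv n).symm.trans
    ((taylorCoeff_congr h n).trans (taylorCoeff_mul hf (analyticAt_const.add hp) n))
  have q0 : taylorCoeff (fun z => 1 + p z) 0 = 1 := by simp [taylorCoeff_zero, hp0]
  have q (n : ℕ) : taylorCoeff (fun z => 1 + p z) (n + 1) = taylorCoeff p (n + 1) := by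
    have h1 : (n + 1 : ℂ) ≠ 0 := by exact_mod_cast n.succ_ne_zero
    have hd : deriv (fun z => 1 + p z) = deriv p := by
      ext z; exact deriv_const_add 1
    have := taylorCoeff_deriv (fun z => 1 + p z) n
    rw [hd, taylorCoeff_deriv] at this
    exact (mul_left_cancel₀ h1 this).symm
  -- At index `n` the term `aₙ` occurs on both sides, which leaves the factor `n - 1`; index 1 would
  -- carry no information.
  have e2 := hc 2
  have e3 := hc 3
  have e4 := hc 4
  have e5 := hc 5
  simp only [Pi.add_def, Finset.sum_range_succ, Finset.sum_range_zero, taylorCoeff_deriv,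
    taylorCoeff_id] at e2 e3 e4 e5
  have q1 := q 0
  have q2 := q 1
  have q3 := q 2
  have q4 := q 3
  norm_num at q1 q2 q3 q4
  norm_num [q0, q1, q2, q3, q4, a0, a1] at e2 e3 e4 e5
  refine ⟨a1, ?_, ?_, ?_, ?_⟩
  · linear_combination e2
  · linear_combination e3
  · linear_combination e4
  · linear_combination e5

lemma hankelDet_three_one (f : ℂ → ℂ) (h1 : taylorCoeff f 1 = 1) :
    hankelDet 3 1 f =
      taylorCoeff f 3 * (taylorCoeff f 2 * taylorCoeff f 4 - taylorCoeff f 3 ^ 2) -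
      taylorCoeff f 4 * (taylorCoeff f 4 - taylorCoeff f 2 * taylorCoeff f 3) +
      taylorCoeff f 5 * (taylorCoeff f 3 - taylorCoeff f 2 ^ 2) := by
  simp [hankelDet, Matrix.det_fin_three, h1]
  ring

lemma norm_hankel_polynomial_le {a b c d : ℂ}
    (h : ‖a‖ ^ 2 + ‖b‖ ^ 2 + ‖c‖ ^ 2 + ‖d‖ ^ 2 ≤ 1) :
    ‖-(c ^ 2 / 9) + b * d / 8 - b ^ 3 / 16 + a * b * c / 6 - a ^ 2 * d / 8 + a ^ 3 * c / 54 -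
      a ^ 4 * b / 72 - a ^ 6 / 1296‖ ≤ 1 / 4 := by
  have ht : ‖-(c ^ 2 / 9) + b * d / 8 - b ^ 3 / 16 + a * b * c / 6 - a ^ 2 * d / 8 +
      a ^ 3 * c / 54 - a ^ 4 * b / 72 - a ^ 6 / 1296‖ ≤
      ‖c‖ ^ 2 / 9 + ‖b‖ * ‖d‖ / 8 + ‖b‖ ^ 3 / 16 + ‖a‖ * ‖b‖ * ‖c‖ / 6 + ‖a‖ ^ 2 * ‖d‖ / 8 +
      ‖a‖ ^ 3 * ‖c‖ / 54 + ‖a‖ ^ 4 * ‖b‖ / 72 + ‖a‖ ^ 6 / 1296 := by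
    refine (norm_sub_le _ _).trans (add_le_add ((norm_sub_le _ _).trans (add_le_add
      ((norm_add_le _ _).trans (add_le_add ((norm_sub_le _ _).trans (add_le_add
      ((norm_add_le _ _).trans (add_le_add ((norm_sub_le _ _).trans (add_le_add
      ((norm_add_le _ _).trans (add_le_add ?_ ?_)) ?_)) ?_)) ?_)) ?_)) ?_)) ?_) <;> simp
  refine ht.trans ?_
  have ha := norm_nonneg a
  have hb := norm_nonneg b
  have hc := norm_nonneg c
  have hd := norm_nonneg d
  generalize ‖a‖ = x at *
  generalize ‖b‖ = y at *
  generalize ‖c‖ = z at *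
  generalize ‖d‖ = w at *
  have hx : x ≤ 1 := by nlinarith
  have hy : y ≤ 1 := by nlinarith
  have hz : z ≤ 1 := by nlinarith
  have hw : w ≤ 1 := by nlinarith
  have hx2 : 0 ≤ x ^ 2 := sq_nonneg x
  have hyz : 0 ≤ y * z := mul_nonneg hb hc
  have hxz : 0 ≤ x * z := mul_nonneg ha hc
  have t1 : y ^ 3 ≤ y ^ 2 := pow_le_pow_of_le_one hb hy (by norm_num)
  have t2 : x * y * z ≤ y * z := by nlinarith
  have t3 : x ^ 2 * w ≤ x ^ 2 := mul_le_of_le_one_right hx2 hw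
  have t4 : x ^ 3 * z ≤ x ^ 2 := by
    calc x ^ 3 * z ≤ x ^ 3 := mul_le_of_le_one_right (by positivity) hz
      _ ≤ x ^ 2 := pow_le_pow_of_le_one ha hx (by norm_num)
  have t5 : x ^ 4 * y ≤ x ^ 2 := by
    calc x ^ 4 * y ≤ x ^ 4 := mul_le_of_le_one_right (by positivity) hy
      _ ≤ x ^ 2 := pow_le_pow_of_le_one ha hx (by norm_num)
  have t6 : x ^ 6 ≤ x ^ 2 := pow_le_pow_of_le_one ha hx (by norm_num)
  -- AM-GM on `yw` and `yz` leaves a diagonal form whose largest coefficient is `5/24`, that of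
  -- `y²`.
  nlinarith [sq_nonneg (y - w), sq_nonneg (y - z), sq_nonneg y, sq_nonneg z, sq_nonneg w]

theorem mainTheorem3 (f : ℂ → ℂ) (hf : IsClassGsh f) : ‖hankelDet 3 1 f‖ ≤ 1 / 4 := by
  obtain ⟨ω, hω, hsub⟩ := hf.subordinate
  have hmem : (0 : ℂ) ∈ unitDisc := Metric.mem_ball_self one_pos
  have hωA : AnalyticAt ℂ ω 0 := hω.analytic 0 hmem
  have hω0 : ω 0 = 0 := by simpa using hω.norm_le 0 hmem
  obtain ⟨s1, s2, s3, s4⟩ := taylorCoeff_sinh_comp hωA hω0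
  obtain ⟨a1, a2, a3, a4, a5⟩ := taylorCoeff_of_mul_deriv_eq hf.classA
    (p := fun z => Complex.sinh (ω z)) (Complex.analyticAt_sinh.comp hωA) (by simp [hω0])
    (fun z hz => hf.mul_deriv_eq hsub hz)
  rw [s1] at a2 a3 a4 a5
  rw [s2] at a3 a4 a5
  rw [s3] at a4 a5
  rw [s4] at a5
  -- Five terms reach `c₄`, as the sum starts at `c₀ = 0`.
  have hbound := sum_sq_taylorCoeff_le hω.analytic
    (fun z hz => (hω.norm_le z hz).trans (mem_ball_zero_iff.1 hz).le) 5
  simp only [Finset.sum_range_succ, Finset.sum_range_zero, taylorCoeff_zero, hω0,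
    norm_zero] at hbound
  norm_num at hbound
  rw [hankelDet_three_one f a1]
  convert norm_hankel_polynomial_le hbound using 2
  generalize taylorCoeff ω 1 = c₁ at *
  generalize taylorCoeff ω 2 = c₂ at *
  generalize taylorCoeff ω 3 = c₃ at *
  generalize taylorCoeff ω 4 = c₄ at *
  rw [a2] at a3 a4 a5
  have a3' : taylorCoeff f 3 = (c₂ + c₁ ^ 2) / 2 := by linear_combination a3 / 2
  rw [a3'] at a4 a5
  have a4' := eq_div_of_mul_eq (three_ne_zero' ℂ) ((mul_comm _ _).trans a4)
  rw [a4'] at a5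
  have a5' := eq_div_of_mul_eq (by norm_num : (4 : ℂ) ≠ 0) ((mul_comm _ _).trans a5)
  rw [a5', a4', a3', a2]
  ring
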